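/- Let $s$ be the stack-sorting map: to compute $s(\pi)$ for a permutation $\pi=\pi_1\cdots\pi_n$ of $\{1,\dots,n\}$ (in one-line notation), read $\pi$ from left to right with an initially empty stack; before pushing $\pi_k$, pop into the output, one at a time, the top of the stack as long as it is smaller than $\pi_k$; after the last entry has been pushed, pop all remaining entries into the output. Let $\mathbf e=12\cdots n$ and $\mathcal S^{\pi}=\{\pi,s(\pi),s^2(\pi),\dots,\mathbf e\}$, viewed as a set of points of $\mathbb R^n$. For a nonempty lattice polytope $P\subset\mathbb R^n$, its $h^*$-polynomial $h^*(P;z)$ is the polynomial with integer coefficients determined by $$1+\sum_{t\ge 1}|tP\cap\mathbb Z^n|\,z^t=\frac{h^*(P;z)}{(1-z)^{\dim P+1}}.$$ Let $n\ge 3$ and let $\pi$ be a permutation of $\{1,\dots,n\}$ of the form $\pi=2Ln1$, where $L$ is any permutation of $\{3,4,\dots,n-1\}$ (empty if $n=3$). Let $\triangle_1:=\operatorname{conv}(\mathcal S^{\pi})$ and $\triangle_2:=\operatorname{conv}(\mathcal S^{\pi}\setminus\{\mathbf e\})$. Then $\triangle_1$ and $\triangle_2$ have the same $h^*$-polynomial.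 -/

import Mathlib

open scoped Pointwise

namespace StackSorting

/-- One pass of the stack-sorting algorithm. The first argument is the part of the input still to
be read, the second is the current stack, listed from its top down; the value is the output still
to be written. On reading `x`, all entries smaller than `x` are popped from the top of the stack
one after the other, then `x` is pushed. When the input is exhausted the stack is emptied. -/
def stackSortAux : List ℕ → List ℕ → List ℕ
  | [], stack => stack
  | x :: input, stack =>
      stack.takeWhile (fun t => decide (t < x)) ++
        stackSortAux input (x :: stack.dropWhile (fun t => decide (t < x)))

/-- The stack-sorting map `s`, on permutations in one-line notation: one pass of the algorithm,
starting from the empty stack. -/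
def stackSort (w : List ℕ) : List ℕ := stackSortAux w []

/-- The set `{w, s(w), s²(w), …}` of all iterates of the stack-sorting map on `w`. For a
permutation `w` of `1, …, n` the iterates become constant, equal to `12⋯n`. -/
def stackSortOrbit (w : List ℕ) : Set (List ℕ) := Set.range fun k : ℕ => stackSort^[k] w

/-- The identity permutation `12⋯n` in one-line notation. -/
def identityWord (n : ℕ) : List ℕ := List.range' 1 n

/-- The point `(w₁, …, wₙ)` of `ℝⁿ` given by a word `w` of length `n`. -/
def wordPoint (n : ℕ) (w : List ℕ) : Fin n → ℝ := fun i => (w.getD (i : ℕ) 0 : ℝ)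

/-- The convex hull in `ℝⁿ` of the points given by a set of words of length `n`. -/
def wordPolytope (n : ℕ) (S : Set (List ℕ)) : Set (Fin n → ℝ) :=
  convexHull ℝ (wordPoint n '' S)

end StackSorting

namespace Ehrhart

/-- The integer lattice `ℤⁿ` in `ℝⁿ`. -/
def integerLattice (n : ℕ) : Set (Fin n → ℝ) :=
  Set.range fun z : Fin n → ℤ => fun i => (z i : ℝ)

/-- The lattice-point enumerator `L(P; t) = |tP ∩ ℤⁿ|`. The count is finite for bounded `P`. -/
noncomputable def latticePointEnumerator {n : ℕ} (P : Set (Fin n → ℝ)) (t : ℕ) : ℕ :=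
  (((t : ℝ) • P) ∩ integerLattice n).ncard

/-- The Ehrhart series `Ehr(P; z) = 1 + ∑_{t ≥ 1} L(P; t) zᵗ`. -/
noncomputable def ehrhartSeries {n : ℕ} (P : Set (Fin n → ℝ)) : PowerSeries ℤ :=
  1 + PowerSeries.mk fun t => if t = 0 then 0 else (latticePointEnumerator P t : ℤ)

/-- The dimension of a (nonempty) polytope: the dimension of its affine hull. -/
noncomputable def polytopeDim {n : ℕ} (P : Set (Fin n → ℝ)) : ℕ :=
  Module.finrank ℝ (vectorSpan ℝ P)

/-- `h` is the `h*`-polynomial of `P`, that is, `Ehr(P; z) = h(z) / (1 - z)^(dim P + 1)`. -/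
def IsHStarPolynomial {n : ℕ} (P : Set (Fin n → ℝ)) (h : Polynomial ℤ) : Prop :=
  ehrhartSeries P * (1 - PowerSeries.X) ^ (polytopeDim P + 1) = (h : PowerSeries ℤ)

/-- A set has at most one `h*`-polynomial. -/
theorem IsHStarPolynomial.unique {n : ℕ} {P : Set (Fin n → ℝ)} {h h' : Polynomial ℤ}
    (H : IsHStarPolynomial P h) (H' : IsHStarPolynomial P h') : h = h' :=
  Polynomial.coe_injective ℤ (H.symm.trans H')

end Ehrhart

/-! Each pass moves the entry 1 one place left and leaves everything to its right sorted, so the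
orbit consists of n-1 words starting with 2, followed by `𝐞`, which starts with 1
(`IsTwoOneWord.stackSort`). The moving 1 makes these n points a triangular system, hence affinely
independent, and △₁ is a lattice simplex that is a pyramid of lattice height one over △₂.

For a lattice simplex, each factor 1 - z of the denominator forces one barycentric coefficient below
1, so h* counts the lattice points of the half-open box (`coeffSeries_empty_mul_pow`). At height one
the first coordinate makes the apex coefficient an integer; once below 1 it vanishes, and only the
count for the base remains (`coeffSeries_pyramid`). -/

namespace Ehrhart

/-! ### Lattice points of the cone over a simplex -/

variable {ι : Type*} [Fintype ι] {n : ℕ}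

lemma integerLattice_add {x y : Fin n → ℝ} (hx : x ∈ integerLattice n)
    (hy : y ∈ integerLattice n) : x + y ∈ integerLattice n := by
  obtain ⟨a, rfl⟩ := hx
  obtain ⟨b, rfl⟩ := hy
  exact ⟨a + b, by ext i; simp⟩

lemma integerLattice_sub {x y : Fin n → ℝ} (hx : x ∈ integerLattice n)
    (hy : y ∈ integerLattice n) : x - y ∈ integerLattice n := by
  obtain ⟨a, rfl⟩ := hx
  obtain ⟨b, rfl⟩ := hy
  exact ⟨a - b, by ext i; simp⟩

/-- The nonnegative coefficient vectors of total weight `t`, with the coefficients indexed by `J`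
less than `1`, for which the corresponding combination of the points `v i` is a lattice point. -/
def latticeCoeffs (v : ι → Fin n → ℝ) (J : Set ι) (t : ℕ) : Set (ι → ℝ) :=
  {w | (∀ i, 0 ≤ w i) ∧ (∀ i ∈ J, w i < 1) ∧ ∑ i, w i = t ∧
    ∑ i, w i • v i ∈ integerLattice n}

/-- The generating function of the number of lattice coefficient vectors by total weight. -/
noncomputable def coeffSeries (v : ι → Fin n → ℝ) (J : Set ι) : PowerSeries ℤ :=
  PowerSeries.mk fun t => ((latticeCoeffs v J t).ncard : ℤ)

lemma affineIndependent_of_fintype {v : ι → Fin n → ℝ}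
    (h : ∀ w : ι → ℝ, ∑ i, w i = 0 → ∑ i, w i • v i = 0 → ∀ i, w i = 0) :
    AffineIndependent ℝ v := by
  rw [affineIndependent_iff]
  intro s w hw hv i hi
  classical
  have := h (fun i => if i ∈ s then w i else 0) (by simpa using hw)
    (by simpa [ite_smul] using hv) i
  simpa [hi] using this

lemma injOn_sum_smul {v : ι → Fin n → ℝ} (hv : AffineIndependent ℝ v) (t : ℝ) :
    Set.InjOn (fun w : ι → ℝ => ∑ i, w i • v i) {w | ∑ i, w i = t} := by
  intro w hw w' hw' h
  have hw : ∑ i, w i = t := hw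
  have hw' : ∑ i, w' i = t := hw'
  have h : ∑ i, w i • v i = ∑ i, w' i • v i := h
  have := affineIndependent_iff.1 hv Finset.univ (w - w')
    (by simp [Finset.sum_sub_distrib, hw, hw'])
    (by simp [Finset.sum_sub_distrib, sub_smul, h])
  ext i
  exact sub_eq_zero.1 (this i (Finset.mem_univ i))

/-- The weights are determined by the lattice point they produce, and these points are bounded.
Finiteness is what makes `ncard` additive below. -/
lemma finite_latticeCoeffs {v : ι → Fin n → ℝ} (hv : AffineIndependent ℝ v) (J : Set ι) (t : ℕ) :
    (latticeCoeffs v J t).Finite := by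
  have hinj : Set.InjOn (fun w : ι → ℝ => ∑ i, w i • v i) (latticeCoeffs v J t) :=
    (injOn_sum_smul hv t).mono fun w hw => hw.2.2.1
  refine Set.Finite.of_finite_image ?_ hinj
  obtain ⟨B, hB⟩ : ∃ B : ℕ, ∀ j, ∑ i, t * |v i j| ≤ B := by
    obtain ⟨B, hB⟩ := exists_nat_ge (∑ j, ∑ i, t * |v i j|)
    refine ⟨B, fun j => le_trans ?_ hB⟩
    exact Finset.single_le_sum (f := fun j => ∑ i, t * |v i j|)
      (fun j _ => Finset.sum_nonneg fun i _ => by positivity) (Finset.mem_univ j)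
  refine ((Set.finite_Icc (fun _ => -(B : ℤ)) (fun _ : Fin n => (B : ℤ))).image
    (fun z : Fin n → ℤ => fun i => (z i : ℝ))).subset ?_
  rintro _ ⟨w, ⟨h0, -, hs, z, hz⟩, rfl⟩
  refine ⟨z, ?_, hz⟩
  have key : ∀ j, |(z j : ℝ)| ≤ B := by
    intro j
    have hj : (z j : ℝ) = ∑ i, w i * v i j := by
      have := congrFun hz j
      simpa using this
    rw [hj]
    refine (Finset.abs_sum_le_sum_abs _ _).trans (le_trans ?_ (hB j))
    refine Finset.sum_le_sum fun i _ => ?_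
    rw [abs_mul, abs_of_nonneg (h0 i)]
    refine mul_le_mul_of_nonneg_right ?_ (abs_nonneg _)
    rw [← hs]
    exact Finset.single_le_sum (fun i _ => h0 i) (Finset.mem_univ i)
  have key' : ∀ j, |z j| ≤ B := fun j => by exact_mod_cast key j
  exact ⟨fun j => (abs_le.1 (key' j)).1, fun j => (abs_le.1 (key' j)).2⟩

lemma latticeCoeffs_zero (v : ι → Fin n → ℝ) (J : Set ι) : latticeCoeffs v J 0 = {0} := by
  ext w
  constructor
  · rintro ⟨h0, -, hs, -⟩
    have := (Finset.sum_eq_zero_iff_of_nonneg fun i _ => h0 i).1 (by simpa using hs)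
    ext i
    exact this i (Finset.mem_univ i)
  · rintro rfl
    exact ⟨fun _ => le_rfl, fun _ _ => one_pos, by simp, 0, by ext; simp⟩

/-- A coefficient at `a` that is at least 1 can be lowered by 1: this subtracts the lattice vector
`v a`, and the bounds on `J` are untouched as `a ∉ J`. -/
lemma latticeCoeffs_succ [DecidableEq ι] {v : ι → Fin n → ℝ}
    (hz : ∀ i, v i ∈ integerLattice n) {J : Set ι} {a : ι} (ha : a ∉ J) (t : ℕ) :
    latticeCoeffs v J (t + 1) =
      latticeCoeffs v (insert a J) (t + 1) ∪ (· + Pi.single a 1) '' latticeCoeffs v J t := by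
  have hsum (w : ι → ℝ) : ∑ i, (w + Pi.single a (1 : ℝ) : ι → ℝ) i = ∑ i, w i + 1 := by
    simp [Finset.sum_add_distrib]
  have hvec (w : ι → ℝ) : ∑ i, (w + Pi.single a (1 : ℝ) : ι → ℝ) i • v i = ∑ i, w i • v i + v a := by
    simp [Finset.sum_add_distrib, add_smul, Pi.single_apply, ite_smul]
  ext w
  constructor
  · rintro ⟨h0, hJ, hs, hl⟩
    rcases lt_or_ge (w a) 1 with h | h
    · left
      refine ⟨h0, ?_, hs, hl⟩
      rintro i (rfl | hi)
      exacts [h, hJ i hi]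
    · right
      obtain ⟨u, rfl⟩ : ∃ u, w = u + Pi.single a 1 := ⟨w - Pi.single a 1, by simp⟩
      refine ⟨u, ⟨fun i => ?_, fun i hi => ?_, ?_, ?_⟩, rfl⟩
      · by_cases hi : i = a
        · subst hi; simpa using h
        · simpa [hi] using h0 i
      · have hia : i ≠ a := fun h => ha (h ▸ hi)
        simpa [hia] using hJ i hi
      · rw [hsum] at hs
        push_cast at hs
        linarith
      · rw [hvec] at hl
        simpa using integerLattice_sub hl (hz a)
  · rintro (⟨h0, hJ, hs, hl⟩ | ⟨u, ⟨h0, hJ, hs, hl⟩, rfl⟩)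
    · exact ⟨h0, fun i hi => hJ i (Or.inr hi), hs, hl⟩
    · refine ⟨fun i => ?_, fun i hi => ?_, ?_, ?_⟩
      · have : (0 : ℝ) ≤ (Pi.single a 1 : ι → ℝ) i := by
          rw [Pi.single_apply]; split_ifs <;> norm_num
        exact add_nonneg (h0 i) this
      · have hia : i ≠ a := fun h => ha (h ▸ hi)
        simpa [hia] using hJ i hi
      · beta_reduce
        rw [hsum, hs]; push_cast; rfl
      · beta_reduce
        rw [hvec]
        exact integerLattice_add hl (hz a)

lemma coeffSeries_mul_one_sub_X {v : ι → Fin n → ℝ} (hv : AffineIndependent ℝ v)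
    (hz : ∀ i, v i ∈ integerLattice n) {J : Set ι} {a : ι} (ha : a ∉ J) :
    coeffSeries v J * (1 - PowerSeries.X) = coeffSeries v (insert a J) := by
  classical
  ext t
  rw [mul_sub, mul_one, map_sub]
  cases t with
  | zero => simp [coeffSeries, latticeCoeffs_zero]
  | succ t =>
    rw [PowerSeries.coeff_succ_mul_X]
    simp only [coeffSeries, PowerSeries.coeff_mk]
    rw [latticeCoeffs_succ hz ha, Set.ncard_union_eq ?_ (finite_latticeCoeffs hv _ _)
      ((finite_latticeCoeffs hv _ _).image _),
      Set.ncard_image_of_injective _ (add_left_injective _)]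
    · push_cast; ring
    · rw [Set.disjoint_left]
      rintro _ h ⟨u, hu, rfl⟩
      have h1 := h.2.1 a (Or.inl rfl)
      have h2 := hu.1 a
      simp at h1
      linarith

/-- Coefficients below 1 bound the total weight by the number of vertices, so the series stops. -/
lemma coeffSeries_univ (v : ι → Fin n → ℝ) :
    ∃ h : Polynomial ℤ, coeffSeries v Set.univ = (h : PowerSeries ℤ) := by
  refine ⟨PowerSeries.trunc (Fintype.card ι + 1) (coeffSeries v Set.univ), ?_⟩
  ext t
  rw [Polynomial.coeff_coe, PowerSeries.coeff_trunc]
  split_ifs with ht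
  · rfl
  · simp only [coeffSeries, PowerSeries.coeff_mk]
    suffices latticeCoeffs v Set.univ t = ∅ by simp [this]
    refine Set.eq_empty_of_forall_notMem fun w ⟨_, h1, hs, _⟩ => ht ?_
    have : ∑ i, w i ≤ ∑ _i : ι, (1 : ℝ) := Finset.sum_le_sum fun i _ => (h1 i trivial).le
    rw [hs] at this
    simp at this
    have : t ≤ Fintype.card ι := by exact_mod_cast this
    omega

lemma coeffSeries_empty_mul_pow {v : ι → Fin n → ℝ} (hv : AffineIndependent ℝ v)
    (hz : ∀ i, v i ∈ integerLattice n) :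
    coeffSeries v ∅ * (1 - PowerSeries.X) ^ Fintype.card ι = coeffSeries v Set.univ := by
  classical
  have : ∀ s : Finset ι,
      coeffSeries v ∅ * (1 - PowerSeries.X) ^ s.card = coeffSeries v (s : Set ι) := by
    intro s
    induction s using Finset.induction_on with
    | empty => simp
    | insert a s ha ih =>
      rw [Finset.card_insert_of_notMem ha, pow_succ, ← mul_assoc, ih,
        coeffSeries_mul_one_sub_X hv hz (by simpa using ha), Finset.coe_insert]
  simpa using this Finset.univ

/-! ### Ehrhart series of lattice simplices -/

lemma convexHull_range_eq_image_stdSimplex (v : ι → Fin n → ℝ) :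
    convexHull ℝ (Set.range v) = (fun w : ι → ℝ => ∑ i, w i • v i) '' stdSimplex ℝ ι := by
  classical
  apply Set.Subset.antisymm
  · refine convexHull_min ?_ ?_
    · rintro _ ⟨i, rfl⟩
      exact ⟨Pi.single i 1, single_mem_stdSimplex ℝ i, by simp [Pi.single_apply, ite_smul]⟩
    · exact (convex_stdSimplex ℝ ι).linear_image (Fintype.linearCombination ℝ v)
  · rintro _ ⟨w, hw, rfl⟩
    exact mem_convexHull_of_exists_fintype w v hw.1 hw.2 (fun i => ⟨i, rfl⟩) rfl

lemma latticePointEnumerator_simplex {v : ι → Fin n → ℝ} (hv : AffineIndependent ℝ v)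
    {t : ℕ} (ht : t ≠ 0) :
    latticePointEnumerator (convexHull ℝ (Set.range v)) t = (latticeCoeffs v ∅ t).ncard := by
  have hinj : Set.InjOn (fun w : ι → ℝ => ∑ i, w i • v i) (latticeCoeffs v ∅ t) :=
    (injOn_sum_smul hv t).mono fun w hw => hw.2.2.1
  rw [latticePointEnumerator, ← hinj.ncard_image,
    convexHull_range_eq_image_stdSimplex]
  congr 1
  have ht' : (0 : ℝ) < t := by positivity
  ext x
  constructor
  · rintro ⟨⟨_, ⟨w, hw, rfl⟩, rfl⟩, hx⟩
    have e : ∑ i, (t * w i) • v i = (t : ℝ) • ∑ i, w i • v i := by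
      rw [Finset.smul_sum]
      exact Finset.sum_congr rfl fun i _ => mul_smul _ _ _
    refine ⟨fun i => t * w i, ⟨fun i => mul_nonneg ht'.le (hw.1 i), by simp, ?_, ?_⟩, e⟩
    · rw [← Finset.mul_sum, hw.2, mul_one]
    · rw [e]; exact hx
  · rintro ⟨w, ⟨h0, -, hs, hl⟩, rfl⟩
    refine ⟨⟨_, ⟨fun i => (t : ℝ)⁻¹ * w i, ⟨fun i => ?_, ?_⟩, rfl⟩, ?_⟩, hl⟩
    · exact mul_nonneg (by positivity) (h0 i)
    · rw [← Finset.mul_sum, hs, inv_mul_cancel₀ ht'.ne']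
    · simp only [Finset.smul_sum, smul_smul]
      exact Finset.sum_congr rfl fun i _ => by rw [mul_inv_cancel_left₀ ht'.ne']

lemma ehrhartSeries_simplex {v : ι → Fin n → ℝ} (hv : AffineIndependent ℝ v) :
    ehrhartSeries (convexHull ℝ (Set.range v)) = coeffSeries v ∅ := by
  ext t
  rw [ehrhartSeries, map_add, PowerSeries.coeff_mk, coeffSeries, PowerSeries.coeff_mk,
    PowerSeries.coeff_one]
  split_ifs with ht
  · subst ht; simp [latticeCoeffs_zero]
  · rw [latticePointEnumerator_simplex hv ht, zero_add]

lemma polytopeDim_simplex [Nonempty ι] {v : ι → Fin n → ℝ} (hv : AffineIndependent ℝ v) :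
    polytopeDim (convexHull ℝ (Set.range v)) + 1 = Fintype.card ι := by
  rw [polytopeDim, ← direction_affineSpan, affineSpan_convexHull, direction_affineSpan,
    hv.finrank_vectorSpan (n := Fintype.card ι - 1)]
  all_goals have := Fintype.card_pos (α := ι); omega

lemma isHStarPolynomial_simplex_iff [Nonempty ι] {v : ι → Fin n → ℝ}
    (hv : AffineIndependent ℝ v) (hz : ∀ i, v i ∈ integerLattice n) {h : Polynomial ℤ} :
    IsHStarPolynomial (convexHull ℝ (Set.range v)) h ↔
      coeffSeries v Set.univ = (h : PowerSeries ℤ) := by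
  rw [IsHStarPolynomial, ehrhartSeries_simplex hv, polytopeDim_simplex hv,
    coeffSeries_empty_mul_pow hv hz]

/-! ### Pyramids of height one -/

/-- If a coordinate takes the value `c` on the base and `c - 1` at the apex of a lattice pyramid,
then no coefficient vector counted by the generating function uses a fractional part of the apex. -/
lemma coeffSeries_pyramid {v : Option ι → Fin n → ℝ} {j : Fin n} {c : ℤ}
    (hbase : ∀ i, v (some i) j = c) (hapex : v none j = c - 1) :
    coeffSeries v {none} = coeffSeries (fun i => v (some i)) ∅ := by
  ext t
  simp only [coeffSeries, PowerSeries.coeff_mk, Nat.cast_inj]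
  let e : (ι → ℝ) → Option ι → ℝ := fun w o => o.elim 0 w
  have he : Function.Injective e := fun w w' h => funext fun i => congrFun h (some i)
  rw [← Set.ncard_image_of_injective _ he]
  congr 1
  ext w
  constructor
  · rintro ⟨h0, h1, hs, hl⟩
    have hw : w none = 0 := by
      obtain ⟨z, hz⟩ := hl
      have hj : (z j : ℝ) = w none * (c - 1) + (∑ i, w (some i)) * c := by
        have := congrFun hz j
        simpa [Fintype.sum_option, hbase, hapex, Finset.sum_mul] using this
      rw [Fintype.sum_option] at hs
      -- Coordinate `j` of the lattice point is `t * c` minus the apex coefficient, which is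
      -- therefore an integer in [0, 1).
      have hr : w none = ((t * c - z j : ℤ) : ℝ) := by
        push_cast
        rw [hj, ← hs]
        ring
      have ha := h0 none
      have hb := h1 none rfl
      rw [hr] at ha hb ⊢
      norm_cast at ha hb ⊢
      omega
    rw [Fintype.sum_option, hw] at hs hl
    refine ⟨fun i => w (some i), ⟨fun i => h0 _, by simp, by simpa using hs,
      by simpa using hl⟩, ?_⟩
    funext o
    cases o with
    | none => exact hw.symm
    | some i => rfl
  · rintro ⟨u, ⟨h0, -, hs, hl⟩, rfl⟩
    refine ⟨?_, ?_, ?_, ?_⟩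
    · rintro (_ | i)
      exacts [le_rfl, h0 i]
    · rintro _ rfl
      exact one_pos
    · rw [Fintype.sum_option]; simpa [e] using hs
    · rw [Fintype.sum_option]; simpa [e] using hl

/-- A lattice pyramid of height one over a lattice simplex has the `h*`-polynomial of its base. -/
theorem exists_isHStarPolynomial_pyramid [Nonempty ι] {v : Option ι → Fin n → ℝ}
    (hv : AffineIndependent ℝ v) (hz : ∀ i, v i ∈ integerLattice n) {j : Fin n} {c : ℤ}
    (hbase : ∀ i, v (some i) j = c) (hapex : v none j = c - 1) :
    ∃ h : Polynomial ℤ, IsHStarPolynomial (convexHull ℝ (Set.range v)) h ∧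
      IsHStarPolynomial (convexHull ℝ (Set.range fun i => v (some i))) h := by
  have hv' : AffineIndependent ℝ fun i => v (some i) :=
    hv.comp_embedding Function.Embedding.some
  obtain ⟨h, hh⟩ := coeffSeries_univ fun i => v (some i)
  refine ⟨h, ?_, (isHStarPolynomial_simplex_iff hv' fun i => hz _).2 hh⟩
  rw [isHStarPolynomial_simplex_iff hv hz, ← hh, ← coeffSeries_empty_mul_pow hv hz,
    ← coeffSeries_empty_mul_pow hv' fun i => hz _, ← coeffSeries_pyramid hbase hapex,
    ← LawfulSingleton.insert_empty_eq, ← coeffSeries_mul_one_sub_X hv hz (Set.notMem_empty none),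
    Fintype.card_option, pow_succ']
  ring

end Ehrhart

/-! ### The stack-sorting map -/

namespace StackSorting

lemma stackSortAux_perm (w st : List ℕ) : (stackSortAux w st).Perm (w ++ st) := by
  induction w generalizing st with
  | nil => exact List.Perm.refl _
  | cons x w ih =>
    rw [stackSortAux]
    refine ((ih _).append_left _).trans ?_
    rw [← Multiset.coe_eq_coe]
    conv_rhs => rw [← List.takeWhile_append_dropWhile (p := fun t => decide (t < x)) (l := st)]
    simp only [← Multiset.coe_add, ← Multiset.cons_coe, List.cons_append]
    simp only [← Multiset.singleton_add]
    abel

lemma stackSort_perm (w : List ℕ) : (stackSort w).Perm w := by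
  simpa [stackSort] using stackSortAux_perm w []

/-- No input entry exceeds `m`, so `m` stays at the bottom of the stack until the end. -/
lemma stackSortAux_append_singleton {w : List ℕ} {m : ℕ} (hw : ∀ x ∈ w, x ≤ m) (st : List ℕ) :
    stackSortAux w (st ++ [m]) = stackSortAux w st ++ [m] := by
  induction w generalizing st with
  | nil => rfl
  | cons x w ih =>
    have hx : ¬ m < x := not_lt.2 (hw x (by simp))
    have ht : (st ++ [m]).takeWhile (fun t => decide (t < x)) =
        st.takeWhile (fun t => decide (t < x)) := by
      induction st with
      | nil => simp [hx]
      | cons a st ih => by_cases ha : a < x <;> simp [ha, ih]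
    have hd : (st ++ [m]).dropWhile (fun t => decide (t < x)) =
        st.dropWhile (fun t => decide (t < x)) ++ [m] := by
      clear ht
      induction st with
      | nil => simp [hx]
      | cons a st ih => by_cases ha : a < x <;> simp [ha, ih]
    rw [stackSortAux, stackSortAux, ht, hd, ← List.cons_append,
      ih fun y hy => hw y (by simp [hy]), List.append_assoc]

/-- The arrival of `m` empties the stack, so the two halves do not interact. -/
lemma stackSortAux_append_cons {A : List ℕ} {m : ℕ} (B st : List ℕ) (hA : ∀ x ∈ A, x < m)
    (hst : ∀ x ∈ st, x < m) :
    stackSortAux (A ++ m :: B) st = stackSortAux A st ++ stackSortAux B [m] := by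
  induction A generalizing st with
  | nil =>
    simp only [List.nil_append, stackSortAux]
    rw [List.takeWhile_eq_self_iff.2 (by simpa using hst),
      List.dropWhile_eq_nil_iff.2 (by simpa using hst)]
  | cons x A ih =>
    simp only [List.cons_append, stackSortAux]
    rw [ih _ (fun y hy => hA y (by simp [hy])), List.append_assoc]
    intro y hy
    rcases List.mem_cons.1 hy with rfl | hy
    · exact hA _ (by simp)
    · exact hst y ((List.dropWhile_sublist _).subset hy)

/-- The recursive description `s(A m B) = s(A) s(B) m`, where `m` is the largest entry. -/
lemma stackSort_append_cons {A B : List ℕ} {m : ℕ} (hA : ∀ x ∈ A, x < m) (hB : ∀ x ∈ B, x ≤ m) :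
    stackSort (A ++ m :: B) = stackSort A ++ stackSort B ++ [m] := by
  have := stackSortAux_append_singleton hB []
  rw [List.nil_append] at this
  rw [stackSort, stackSortAux_append_cons B [] hA (by simp), this, List.append_assoc]
  rfl

lemma stackSort_append_range' {A : List ℕ} {m : ℕ} (hA : ∀ x ∈ A, x < m) (k : ℕ) :
    stackSort (A ++ List.range' m k) = stackSort A ++ List.range' m k := by
  induction k with
  | zero => simp
  | succ k ih =>
    rw [List.range'_concat, ← List.append_assoc,
      stackSort_append_cons (B := []) _ (by simp), ih]
    · simp [stackSort, stackSortAux]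
    · intro x hx
      rcases List.mem_append.1 hx with hx | hx
      · have := hA x hx; omega
      · rw [List.mem_range'_1] at hx; omega

lemma stackSort_cons {a : ℕ} {w : List ℕ} (hw : ∀ x ∈ w, a < x) :
    stackSort (a :: w) = a :: stackSort w := by
  cases w with
  | nil => rfl
  | cons x w => simp [stackSort, stackSortAux, hw x (by simp)]

lemma stackSort_identityWord (n : ℕ) : stackSort (identityWord n) = identityWord n := by
  simpa [stackSort, stackSortAux, identityWord] using
    stackSort_append_range' (A := []) (m := 1) (by simp) n

/-! ### The orbit of 2Ln1 -/

/-- The words `2 M 1 (p + 3) ⋯ n` with `M` a permutation of `3, …, p + 2` ending in `p + 2`. -/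
def IsTwoOneWord (n p : ℕ) (w : List ℕ) : Prop :=
  ∃ M : List ℕ, M.Perm (List.range' 3 p) ∧ (p ≠ 0 → ∃ M', M = M' ++ [p + 2]) ∧
    w = 2 :: M ++ 1 :: List.range' (p + 3) (n - 2 - p)

/-- With M = M' (p+3), the recursion at the maximum p+3 of the unsorted prefix gives s(2 M') 1
(p+3), and s(2 M') = 2 s(M'). -/
lemma IsTwoOneWord.stackSort {n p : ℕ} {w : List ℕ} (h : IsTwoOneWord n (p + 1) w)
    (hp : p + 1 ≤ n - 2) : IsTwoOneWord n p (stackSort w) := by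
  obtain ⟨M, hM, hlast, rfl⟩ := h
  obtain ⟨M', rfl⟩ := hlast (by omega)
  have hM' : M'.Perm (List.range' 3 p) := by
    rw [List.range'_1_concat, show 3 + p = p + 1 + 2 by omega] at hM
    exact (List.perm_append_right_iff _).1 hM
  have hmem : ∀ x ∈ M', 3 ≤ x ∧ x < p + 3 := fun x hx => by
    have := hM'.subset hx
    rw [List.mem_range'_1] at this
    omega
  refine ⟨StackSorting.stackSort M', (stackSort_perm M').trans hM', fun hp0 => ?_, ?_⟩
  -- The largest entry of `M'` is `p + 2`, and sorting puts it last.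
  · have hp2 : p + 2 ∈ M' := hM'.symm.subset (by rw [List.mem_range'_1]; omega)
    obtain ⟨A, B, rfl⟩ := List.append_of_mem hp2
    have hnd : (A ++ (p + 2) :: B).Nodup := hM'.symm.nodup List.nodup_range'
    refine ⟨_, stackSort_append_cons (fun x hx => ?_) fun x hx => ?_⟩
    · have h1 := (hmem x (by simp [hx])).2
      have h2 : x ≠ p + 2 := by
        rintro rfl
        exact (List.nodup_append.1 hnd).2.2 _ hx _ (by simp) rfl
      omega
    · have h1 := (hmem x (by simp [hx])).2
      omega
  · have h1 : 2 :: (M' ++ [p + 1 + 2]) ++ 1 :: List.range' (p + 1 + 3) (n - 2 - (p + 1)) =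
        ((2 :: M') ++ (p + 3) :: [1]) ++ List.range' (p + 4) (n - 2 - (p + 1)) := by
      simp
    have h2 : n - 2 - p = n - 2 - (p + 1) + 1 := by omega
    rw [h1, stackSort_append_range', stackSort_append_cons, stackSort_cons, h2, List.range'_succ]
    · simp [StackSorting.stackSort, stackSortAux]
    · intro x hx; have := hmem x hx; omega
    · intro x hx
      rcases List.mem_cons.1 hx with rfl | hx
      · omega
      · exact (hmem x hx).2
    · simp
    · intro x hx
      simp only [List.mem_append, List.mem_cons, List.not_mem_nil, or_false] at hx
      rcases hx with (rfl | hx) | rfl | rfl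
      · omega
      · have := hmem x hx; omega
      · omega
      · omega

lemma IsTwoOneWord.stackSort_eq_identityWord {n : ℕ} {w : List ℕ} (h : IsTwoOneWord n 0 w)
    (hn : 2 ≤ n) : StackSorting.stackSort w = identityWord n := by
  obtain ⟨M, hM, -, rfl⟩ := h
  obtain rfl : M = [] := by simpa using hM
  obtain ⟨k, rfl⟩ : ∃ k, n = k + 2 := ⟨n - 2, by omega⟩
  have := stackSort_append_range' (A := [2, 1]) (m := 3) (by simp) k
  simpa [identityWord, List.range'_succ, StackSorting.stackSort, stackSortAux] using this

lemma IsTwoOneWord.iterate {n p : ℕ} {w : List ℕ} (h : IsTwoOneWord n p w) (hp : p ≤ n - 2)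
    {k : ℕ} (hk : k ≤ p) : IsTwoOneWord n (p - k) (StackSorting.stackSort^[k] w) := by
  induction k with
  | zero => exact h
  | succ k ih =>
    rw [Function.iterate_succ_apply']
    refine IsTwoOneWord.stackSort ?_ (by omega)
    rw [show p - (k + 1) + 1 = p - k by omega]
    exact ih (by omega)

lemma IsTwoOneWord.iterate_eq_identityWord {n p : ℕ} {w : List ℕ} (h : IsTwoOneWord n p w)
    (hn : 2 ≤ n) (hp : p ≤ n - 2) {k : ℕ} (hk : p < k) :
    StackSorting.stackSort^[k] w = identityWord n := by
  obtain ⟨j, rfl⟩ : ∃ j, k = j + (p + 1) := ⟨k - (p + 1), by omega⟩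
  have h0 := h.iterate hp le_rfl
  rw [Nat.sub_self] at h0
  rw [Function.iterate_add_apply, Function.iterate_succ_apply', h0.stackSort_eq_identityWord hn,
    Function.iterate_fixed (stackSort_identityWord n)]

/-! ### Coordinates and affine independence -/

lemma wordPoint_mem_integerLattice (n : ℕ) (w : List ℕ) :
    wordPoint n w ∈ Ehrhart.integerLattice n :=
  ⟨fun i => (w.getD i 0 : ℤ), by ext i; simp [wordPoint]⟩

lemma wordPoint_identityWord (n : ℕ) (i : Fin n) : wordPoint n (identityWord n) i = i + 1 := by
  simp [wordPoint, identityWord, List.getD_eq_getElem?_getD, add_comm]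

lemma IsTwoOneWord.wordPoint_zero {n p : ℕ} {w : List ℕ} (h : IsTwoOneWord n p w) (hn : 0 < n) :
    wordPoint n w ⟨0, hn⟩ = 2 := by
  obtain ⟨M, -, -, rfl⟩ := h
  simp [wordPoint]

lemma IsTwoOneWord.wordPoint_eq_one {n p : ℕ} {w : List ℕ} (h : IsTwoOneWord n p w) {i : Fin n}
    (hi : (i : ℕ) = p + 1) : wordPoint n w i = 1 := by
  obtain ⟨M, hM, -, rfl⟩ := h
  have hl : M.length = p := by simpa using hM.length_eq
  simp [wordPoint, hi, List.getD_eq_getElem?_getD, hl]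

lemma IsTwoOneWord.wordPoint_of_lt {n p : ℕ} {w : List ℕ} (h : IsTwoOneWord n p w) {i : Fin n}
    (hi : p + 1 < (i : ℕ)) : wordPoint n w i = i + 1 := by
  obtain ⟨M, hM, -, rfl⟩ := h
  have hl : M.length = p := by simpa using hM.length_eq
  obtain ⟨d, hd⟩ : ∃ d, (i : ℕ) = p + 2 + d := ⟨i - (p + 2), by omega⟩
  have hin := i.isLt
  have h1 : p + 2 + d - (p + 1) = d + 1 := by omega
  have h2 : ¬ (p + 2 + d < p + 1) := by omega
  have h3 : d < n - 2 - p := by omega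
  have h4 : (2 :: M ++ 1 :: List.range' (p + 3) (n - 2 - p)).getD i 0 = i + 1 := by
    rw [hd, List.getD_eq_getElem?_getD, List.getElem?_append]
    simp [hl, h1, h2, h3]
    omega
  rw [wordPoint, h4]
  push_cast
  rfl

/-- The iterates of `s` on a word `2 M 1` before the identity, with the identity added. -/
noncomputable def orbitPoint (n : ℕ) (w : List ℕ) : Option (Fin (n - 1)) → Fin n → ℝ
  | none => wordPoint n (identityWord n)
  | some k => wordPoint n (stackSort^[(k : ℕ)] w)

/-- Relative to `𝐞`, the system is triangular: where iterate m has its 1, all later iterates already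
agree with `𝐞`, so the coefficients vanish one after the other. -/
lemma IsTwoOneWord.affineIndependent_orbitPoint {n : ℕ} {w : List ℕ}
    (h : IsTwoOneWord n (n - 2) w) : AffineIndependent ℝ (orbitPoint n w) := by
  refine Ehrhart.affineIndependent_of_fintype fun c hc hv => ?_
  rw [Fintype.sum_option] at hc hv
  have hcoord : ∀ i : Fin n,
      ∑ k : Fin (n - 1),
        c (some k) * (wordPoint n (StackSorting.stackSort^[(k : ℕ)] w) i - (i + 1)) = 0 := by
    intro i
    have := congrFun hv i
    simp only [orbitPoint, Pi.add_apply, Pi.smul_apply, Finset.sum_apply, smul_eq_mul,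
      Pi.zero_apply, wordPoint_identityWord] at this
    simp only [mul_sub, Finset.sum_sub_distrib, ← Finset.sum_mul]
    linear_combination this - (i + 1 : ℝ) * hc
  have hsome : ∀ (m : ℕ) (hm : m < n - 1), c (some ⟨m, hm⟩) = 0 := by
    intro m
    induction m using Nat.strong_induction_on with
    | _ m ih =>
      intro hm
      -- Iterate `m` has parameter p = n - 2 - m, so its 1 has 0-based position p + 1 = n - 1 - m.
      have hi := hcoord ⟨n - 1 - m, by omega⟩
      rw [Finset.sum_eq_single (⟨m, hm⟩ : Fin (n - 1))] at hi
      · rw [(h.iterate le_rfl (k := m) (by omega)).wordPoint_eq_one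
          (by simp only; omega)] at hi
        refine (mul_eq_zero.1 hi).resolve_right ?_
        have : (0 : ℝ) < ((n - 1 - m : ℕ) : ℝ) := by
          exact_mod_cast (by omega : 0 < n - 1 - m)
        simp only
        linarith
      · rintro ⟨k, hk⟩ - hne
        have hne : k ≠ m := fun h => hne (by simp [h])
        rcases lt_or_gt_of_ne hne with hlt | hgt
        · rw [ih k hlt hk, zero_mul]
        · rw [(h.iterate le_rfl (k := k) (by omega)).wordPoint_of_lt (by simp only; omega),
            sub_self, mul_zero]
      · simp
  rintro (_ | k)
  · simpa [hsome] using hc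
  · exact hsome k k.2

lemma IsTwoOneWord.iterate_ne_identityWord {n : ℕ} {w : List ℕ} (h : IsTwoOneWord n (n - 2) w)
    (hn : 2 ≤ n) {k : ℕ} (hk : k < n - 1) : StackSorting.stackSort^[k] w ≠ identityWord n := by
  intro he
  have h2 := (h.iterate le_rfl (k := k) (by omega)).wordPoint_zero (by omega)
  rw [he, wordPoint_identityWord] at h2
  norm_num at h2

lemma IsTwoOneWord.image_orbit_diff {n : ℕ} {w : List ℕ} (h : IsTwoOneWord n (n - 2) w)
    (hn : 2 ≤ n) : wordPoint n '' (stackSortOrbit w \ {identityWord n}) =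
      Set.range fun k => orbitPoint n w (some k) := by
  ext x
  constructor
  · rintro ⟨_, ⟨⟨k, rfl⟩, hk⟩, rfl⟩
    refine ⟨⟨k, ?_⟩, rfl⟩
    by_contra hlt
    exact hk (h.iterate_eq_identityWord hn le_rfl (by omega))
  · rintro ⟨k, rfl⟩
    exact ⟨_, ⟨⟨k, rfl⟩, h.iterate_ne_identityWord hn k.2⟩, rfl⟩

lemma IsTwoOneWord.image_orbit {n : ℕ} {w : List ℕ} (h : IsTwoOneWord n (n - 2) w)
    (hn : 2 ≤ n) : wordPoint n '' stackSortOrbit w = Set.range (orbitPoint n w) := by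
  have he : identityWord n ∈ stackSortOrbit w :=
    -- Any exponent above n - 2 would do.
    ⟨n, h.iterate_eq_identityWord hn le_rfl (by omega)⟩
  rw [← Set.insert_eq_of_mem he, ← Set.insert_sdiff_singleton, Set.image_insert_eq,
    h.image_orbit_diff hn]
  ext x
  simp [Option.exists, orbitPoint, eq_comm]

end StackSorting

theorem proposition5p3 (n : ℕ) (hn : 3 ≤ n) (L π : List ℕ)
    (hL : L.Perm (List.range' 3 (n - 3)))
    (hπ : π = [2] ++ L ++ [n, 1]) :
    ∃ h : Polynomial ℤ,
      Ehrhart.IsHStarPolynomial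
        (StackSorting.wordPolytope n (StackSorting.stackSortOrbit π)) h ∧
      Ehrhart.IsHStarPolynomial
        (StackSorting.wordPolytope n
          (StackSorting.stackSortOrbit π \ {StackSorting.identityWord n})) h := by
  -- Here M = L n and the sorted tail is empty.
  have hw : StackSorting.IsTwoOneWord n (n - 2) π := by
    refine ⟨L ++ [n], ?_, fun _ => ⟨L, by rw [show n - 2 + 2 = n by omega]⟩, by simp [hπ]⟩
    rw [show n - 2 = n - 3 + 1 by omega, List.range'_1_concat, show 3 + (n - 3) = n by omega]
    exact hL.append_right _
  have : Nonempty (Fin (n - 1)) := ⟨⟨0, by omega⟩⟩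
  rw [StackSorting.wordPolytope, StackSorting.wordPolytope, hw.image_orbit (by omega),
    hw.image_orbit_diff (by omega)]
  refine Ehrhart.exists_isHStarPolynomial_pyramid hw.affineIndependent_orbitPoint
    ?_ (j := ⟨0, by omega⟩) (c := 2) (fun k => ?_) ?_
  · rintro (_ | k) <;> exact StackSorting.wordPoint_mem_integerLattice _ _
  · rw [StackSorting.orbitPoint, (hw.iterate le_rfl (k := k) (by omega)).wordPoint_zero (by omega)]
    norm_num
  · have := StackSorting.wordPoint_identityWord n ⟨0, by omega⟩
    rw [StackSorting.orbitPoint, this]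
    norm_num
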